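/- Let $(\Phi_m)_{m\in\omega}$ be the standard enumeration of the partial computable functions and $\langle\cdot,\cdot\rangle$ a computable pairing function on $\omega$. A sequence $\mathcal U=(U_i)_{i\in\omega}$ of subsets of a countable set $X$ together with a function $k:\omega\times\omega\times X\to\omega$ is a \emph{base} if every $x\in X$ lies in some $U_i$ and, whenever $x\in U_i\cap U_j$, we have $x\in U_{k(i,j,x)}\subseteq U_i\cap U_j$; then $(X,\mathcal U,k)$ is a \emph{countable second-countable (CSC) space}, with the topology that has the sets $U_i$ as a basis. An \emph{index} of a CSC space $(\omega,\mathcal U,k)$ is a number $e=\langle m,n\rangle$ such that $\Phi_m$ is total and is the characteristic function of $\mathcal U$ (that is, $\Phi_m(i,x)=1$ if $x\in U_i$ and $\Phi_m(i,x)=0$ if $x\notin U_i$), and $\Phi_n$ is total and computes $k$. Let $T_2$-$CSC$, $T_{2\frac12}$-$CSC$, $T_3$-$CSC$, $T_4$-$CSC$ and $Met$-$CSC$ be the sets of indices of CSC spaces that are, respectively, Hausdorff; Urysohn (any two distinct points have disjoint closed neighbourhoods); $T_3$ (regular and $T_0$); $T_4$ (normal and $T_1$); metrizable. Let $\Sigma^0_n,\Pi^0_n$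 denote the levels of the arithmetical hierarchy of subsets of $\omega$. For a class $\Gamma$ of subsets of $\omega$ and $A\subseteq C\subseteq\omega$, say that $A$ is \emph{$\Gamma$-complete within $C$} if (i) $A=B\cap C$ for some $B\in\Gamma$, and (ii) for every $B\in\Gamma$ there is a computable $f:\omega\to\omega$ such that for all $e\in\omega$, $f(e)\in C$ and $(e\in B\iff f(e)\in A)$. \textbf{Theorem.} \begin{enumerate} \item $T_3$-$CSC$ is $\Pi^0_5$-complete within $T_2$-$CSC$. \item $T_3$-$CSC$ is $\Pi^0_5$-complete within $T_{2\frac12}$-$CSC$. Moreover, the reductions for (1) can be taken to produce Urysohn spaces always: for every $B\in\Pi^0_5$ there is a computable $f:\omega\to\omega$ such that for all $e$, $f(e)\in T_2\text{-}CSC\cap T_{2\frac12}\text{-}CSC$ and $(e\in B\iff f(e)\in T_3\text{-}CSC)$. \item $T_3$-$CSC=T_4$-$CSC=Met$-$CSC$. In particular, $T_4$-$CSC$ and $Met$-$CSC$ are each $\Pi^0_5$-complete within $T_2$-$CSC$ and within $T_{2\frac12}$-$CSC$. \end{enumerate} -/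

import Mathlib

namespace CSCIndex

/-! ### The arithmetical hierarchy and relative complexity -/

/-- The class `Σ⁰ₙ` of subsets of `ℕ`: `Σ⁰₀` consists of the computable sets, and a set is
`Σ⁰ₙ₊₁` when it is the projection `{x | ∃ y, ⟨x, y⟩ ∈ B}` of a set `B` whose complement
is `Σ⁰ₙ`, that is, of a `Π⁰ₙ` set. -/
def SigmaClass : ℕ → Set (Set ℕ)
  | 0 => {A | ComputablePred fun x => x ∈ A}
  | n + 1 => {A | ∃ B : Set ℕ, Bᶜ ∈ SigmaClass n ∧ ∀ x, x ∈ A ↔ ∃ y, Nat.pair x y ∈ B}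

/-- The class `Π⁰ₙ` of subsets of `ℕ`: the complements of the `Σ⁰ₙ` sets. -/
def PiClass (n : ℕ) : Set (Set ℕ) := {A | Aᶜ ∈ SigmaClass n}

/-- `A` is `Γ` within `C`. -/
def IsWithin (Γ : Set (Set ℕ)) (A C : Set ℕ) : Prop :=
  ∃ B ∈ Γ, A = B ∩ C

/-- `A` is `Γ`-hard within `C`. -/
def IsHardWithin (Γ : Set (Set ℕ)) (A C : Set ℕ) : Prop :=
  ∀ B ∈ Γ, ∃ f : ℕ → ℕ, Computable f ∧ ∀ e, f e ∈ C ∧ (e ∈ B ↔ f e ∈ A)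

/-- `A` is `Γ`-complete within `C`. (That `A ⊆ C` is part of being `Γ` within `C`.) -/
def IsCompleteWithin (Γ : Set (Set ℕ)) (A C : Set ℕ) : Prop :=
  IsWithin Γ A C ∧ IsHardWithin Γ A C

/-! ### Countable second-countable spaces and their indices -/

/-- The sequence `U` and the function `k` form a base for a topology on `X`: the sets `U i` cover
`X`, and whenever `x ∈ U i ∩ U j`, the number `k i j x` is the index of a member of the sequence
with `x ∈ U (k i j x) ⊆ U i ∩ U j`. -/
structure IsBase {X : Type*} (U : ℕ → Set X) (k : ℕ → ℕ → X → ℕ) : Prop where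
  cover : ∀ x, ∃ i, x ∈ U i
  inter : ∀ i j x, x ∈ U i ∩ U j → x ∈ U (k i j x) ∧ U (k i j x) ⊆ U i ∩ U j

/-- `Φ m`, the `m`-th partial computable function. -/
def Φ (m : ℕ) : ℕ →. ℕ := (Denumerable.ofNat Nat.Partrec.Code m).eval

/-- `Φ m` is (total and) the characteristic function of the sequence `U`. -/
def ComputesSets (m : ℕ) (U : ℕ → Set ℕ) : Prop :=
  ∀ i x, (x ∈ U i → Φ m (Nat.pair i x) = Part.some 1) ∧
    (x ∉ U i → Φ m (Nat.pair i x) = Part.some 0)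

/-- `Φ n` is (total and) equal to the function `k`. -/
def ComputesFun (n : ℕ) (k : ℕ → ℕ → ℕ → ℕ) : Prop :=
  ∀ i j x, Φ n (Nat.pair i (Nat.pair j x)) = Part.some (k i j x)

/-- The set of indices `e = ⟨m, n⟩` of computable CSC spaces `(ℕ, U, k)`. -/
def CSC : Set ℕ :=
  {e | ∃ (U : ℕ → Set ℕ) (k : ℕ → ℕ → ℕ → ℕ),
    IsBase U k ∧ ComputesSets e.unpair.1 U ∧ ComputesFun e.unpair.2 k}

/-- The `i`-th basic open set of the space with index `e = ⟨m, n⟩`. -/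
def basicOpen (e i : ℕ) : Set ℕ := {x | Φ e.unpair.1 (Nat.pair i x) = Part.some 1}

/-- The underlying set `ℕ` of the space with index `e`; a copy of `ℕ` that does not carry the
discrete topology. -/
def Space (_e : ℕ) : Type := ℕ

/-- The topology of the space with index `e`, generated by its basic open sets. -/
instance (e : ℕ) : TopologicalSpace (Space e) :=
  TopologicalSpace.generateFrom (Set.range fun i => (basicOpen e i : Set ℕ))

/-- The basic open sets of an index are those of the sequence that the index computes. -/
theorem basicOpen_eq {e : ℕ} {U : ℕ → Set ℕ} (h : ComputesSets e.unpair.1 U) (i : ℕ) :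
    basicOpen e i = U i := by
  ext x
  constructor
  · intro hx
    by_contra hn
    have h0 := (h i x).2 hn
    have h1 : Φ e.unpair.1 (Nat.pair i x) = Part.some 1 := hx
    rw [h0] at h1
    exact absurd (Part.some_injective h1) (by decide)
  · exact fun hx => (h i x).1 hx

/-- For the index of a CSC space, the basic open sets are a base of the topology. -/
theorem isTopologicalBasis_basicOpen {e : ℕ} (he : e ∈ CSC) :
    TopologicalSpace.IsTopologicalBasis (α := Space e)
      (Set.range fun i => (basicOpen e i : Set ℕ)) := by
  obtain ⟨U, k, hb, hU, -⟩ := he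
  have hfun : (fun i => (basicOpen e i : Set ℕ)) = U := funext fun i => basicOpen_eq hU i
  refine ⟨?_, ?_, rfl⟩
  · rw [hfun]
    rintro _ ⟨i, rfl⟩ _ ⟨j, rfl⟩ x hx
    exact ⟨U (k i j x), ⟨_, rfl⟩, (hb.inter i j x hx).1, (hb.inter i j x hx).2⟩
  · rw [hfun]
    refine Set.eq_univ_of_forall fun x => ?_
    obtain ⟨i, hi⟩ := hb.cover x
    exact ⟨U i, ⟨i, rfl⟩, hi⟩

/-- Indices of Hausdorff CSC spaces. -/
def T2CSC : Set ℕ := {e | e ∈ CSC ∧ T2Space (Space e)}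

/-- Indices of Urysohn CSC spaces: distinct points have disjoint closed neighbourhoods. -/
def T25CSC : Set ℕ := {e | e ∈ CSC ∧ T25Space (Space e)}

/-- Indices of regular (`T₃`) CSC spaces. -/
def T3CSC : Set ℕ := {e | e ∈ CSC ∧ T3Space (Space e)}

/-- Indices of normal (`T₄`) CSC spaces. -/
def T4CSC : Set ℕ := {e | e ∈ CSC ∧ T4Space (Space e)}

/-- Indices of metrizable CSC spaces. -/
def MetCSC : Set ℕ := {e | e ∈ CSC ∧ TopologicalSpace.MetrizableSpace (Space e)}

end CSCIndex

namespace CSCIndex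

open Topology

/-! ### The spaces of the reduction -/

/-! Hardness. Over each `a` sits one special point `(a, [], 0)`. Each nonempty list `l` adds a point
`(a, l, 0)`, approached by the isolated points `(a, l, w)` as `w.unpair.1` grows. Apart from its
centre, a ball around the special point consists of isolated points: those with `l` long and `F a l
w`. Clopen sets separate points whatever `F` is, so the space is always Urysohn. Regularity fails at
`(a, [], 0)` exactly when arbitrarily long `l` have `F a l w` with `w.unpair.1` unbounded, for then
`(a, l, 0)` lies in the closure of the special balls (`HasBalls.regularSpace_iff`).

For `F` take `Fires`: it is unbounded on `l` exactly when every entry `c` of `l`, at position `b`,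
refutes `∃ d, ∀ f, S b c d f`. Such lists of every length exist iff each `b` has a refuting `c`,
that is, iff `∃ b, ∀ c, ∃ d, ∀ f, S b c d f` fails (`exists_forall_fires_iff`). The quantifier over
`a` raises this Σ⁰₄ condition to Π⁰₅.

Upper bound. Regularity expressed through basic open sets has the form ∀∃∀∃∀ over membership
questions, which are decidable for genuine indices; replacing them by step-bounded computations
makes the matrix decidable for all `e` (`exists_mem_piClass_forall_regularSpace_iff`). Normality and
metrizability follow from regularity by second countability. -/

/-- Codes of the points of the constructed spaces. The points `(a, l, w)` with `w ≠ 0` are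
isolated; the points `(a, [], 0)` are the only ones at which regularity can fail. -/
abbrev Point : Type := ℕ × List ℕ × ℕ

/-- The basic neighbourhoods of the points. -/
def ball (F : ℕ → List ℕ → ℕ → Prop) (c : Point) (n : ℕ) : Set Point :=
  {x | x = c ∨ (c.2.2 = 0 ∧ x.2.2 ≠ 0 ∧ c.1 = x.1 ∧
    ((c.2.1 = [] ∧ n ≤ x.2.1.length ∧ F x.1 x.2.1 x.2.2) ∨
      (c.2.1 ≠ [] ∧ c.2.1 = x.2.1 ∧ n ≤ x.2.2.unpair.1)))}

section Ball

variable {F : ℕ → List ℕ → ℕ → Prop}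

theorem mem_ball_self (c : Point) (n : ℕ) : c ∈ ball F c n := Or.inl rfl

/-- A point of a ball other than its centre is isolated, so its own balls are singletons. -/
theorem ball_subset_ball {c x : Point} {n m : ℕ} (hx : x ∈ ball F c n) (h : n ≤ m) :
    ball F x m ⊆ ball F c n := by
  rintro y (rfl | ⟨h0, hy, h1, h2⟩)
  · exact hx
  · rcases hx with rfl | hx
    · refine Or.inr ⟨h0, hy, h1, ?_⟩
      rcases h2 with ⟨h2, h3, h4⟩ | ⟨h2, h3, h4⟩
      · exact Or.inl ⟨h2, h.trans h3, h4⟩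
      · exact Or.inr ⟨h2, h3, h.trans h4⟩
    · exact absurd h0 hx.2.1

theorem eq_of_mem_ball_of_ne_zero {c x : Point} {n : ℕ} (hc : c.2.2 ≠ 0) (hx : x ∈ ball F c n) :
    x = c :=
  hx.resolve_right fun h => hc h.1

theorem fst_eq_of_mem_ball {c x : Point} {n : ℕ} (hx : x ∈ ball F c n) : x.1 = c.1 := by
  rcases hx with rfl | hx
  · rfl
  · exact hx.2.2.1.symm

/-- The topology of `α`, whose points are coded by `g`, has the balls of `F` as neighbourhoods. -/
def HasBalls {α : Type*} [TopologicalSpace α] (F : ℕ → List ℕ → ℕ → Prop) (g : α ≃ Point) : Prop :=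
  ∀ S : Set α, IsOpen S ↔ ∀ x ∈ S, ∃ n, g ⁻¹' ball F (g x) n ⊆ S

variable {α : Type*} [TopologicalSpace α] {g : α ≃ Point}

theorem HasBalls.isOpen_ball (h : HasBalls F g) (c : Point) (n : ℕ) :
    IsOpen (g ⁻¹' ball F c n) :=
  (h _).2 fun _ hx => ⟨n, Set.preimage_mono (ball_subset_ball hx le_rfl)⟩

theorem HasBalls.mem_nhds_iff (h : HasBalls F g) {x : α} {S : Set α} :
    S ∈ 𝓝 x ↔ ∃ n, g ⁻¹' ball F (g x) n ⊆ S := by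
  constructor
  · intro hS
    obtain ⟨t, hts, ht, hx⟩ := _root_.mem_nhds_iff.1 hS
    obtain ⟨n, hn⟩ := (h t).1 ht x hx
    exact ⟨n, hn.trans hts⟩
  · rintro ⟨n, hn⟩
    exact Filter.mem_of_superset ((h.isOpen_ball _ n).mem_nhds (mem_ball_self _ n)) hn

theorem HasBalls.isClosed_of_disjoint (h : HasBalls F g) {S : Set Point}
    (hS : ∀ x, x.2.2 = 0 → x ∉ S → ∃ n, ∀ y ∈ ball F x n, y ∉ S) : IsClosed (g ⁻¹' S) := by
  refine isOpen_compl_iff.1 ((h _).2 fun x hx => ?_)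
  by_cases h0 : (g x).2.2 = 0
  · obtain ⟨n, hn⟩ := hS (g x) h0 hx
    exact ⟨n, fun y hy => hn _ hy⟩
  · refine ⟨0, fun y hy => ?_⟩
    have := g.injective (eq_of_mem_ball_of_ne_zero h0 hy)
    exact this ▸ hx

/-- The ball around a non-special centre stays inside a single pair `(a, l)`, which every other
non-isolated point can avoid. -/
theorem HasBalls.isClosed_ball (h : HasBalls F g) {c : Point} (hc : c.2.2 ≠ 0 ∨ c.2.1 ≠ [])
    (n : ℕ) : IsClosed (g ⁻¹' ball F c n) := by
  refine h.isClosed_of_disjoint fun x hx0 hx => ?_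
  have hxc : x ≠ c := fun hh => hx (Or.inl hh)
  by_cases hl : x.2.1 = []
  · refine ⟨c.2.1.length + 1, ?_⟩
    rintro y (rfl | ⟨-, hy0, -, ⟨-, hy, -⟩ | ⟨hl', -⟩⟩) hyc
    · exact hx hyc
    · rcases hyc with rfl | ⟨h0, -, -, ⟨hc', -⟩ | ⟨-, hc', -⟩⟩
      · omega
      · exact hc.elim (fun hc => hc h0) (fun hc => hc hc')
      · rw [← hc'] at hy; omega
    · exact hl' hl
  -- This radius excludes `c` itself when `c` is isolated; otherwise any common point would force `x
  -- = c`.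
  · refine ⟨c.2.2.unpair.1 + 1, ?_⟩
    rintro y (rfl | ⟨-, hy0, hy1, ⟨hl', -⟩ | ⟨-, hy2, hy3⟩⟩) hyc
    · exact hx hyc
    · exact hl hl'
    · rcases hyc with rfl | ⟨h0, -, hc1, ⟨hc', -⟩ | ⟨-, hc', -⟩⟩
      · omega
      · exact hc.elim (fun hc => hc h0) (fun hc => hc hc')
      · exact hxc (Prod.ext (hy1.trans hc1.symm) (Prod.ext (hy2.trans hc'.symm) (hx0.trans h0.symm)))

theorem HasBalls.isClopen_fst_eq (h : HasBalls F g) (a : ℕ) : IsClopen {x | (g x).1 = a} := by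
  constructor
  · exact h.isClosed_of_disjoint (S := {x | x.1 = a}) fun x _ hx =>
      ⟨0, fun y hy hya => hx ((fst_eq_of_mem_ball hy).symm.trans hya)⟩
  · exact (h _).2 fun x hx => ⟨0, fun y hy => (fst_eq_of_mem_ball hy).trans hx⟩

theorem HasBalls.exists_isClopen_of_ne_special (h : HasBalls F g) {x y : α} (hxy : x ≠ y)
    (hx : (g x).2.2 ≠ 0 ∨ (g x).2.1 ≠ []) : ∃ S, IsClopen S ∧ x ∈ S ∧ y ∉ S := by
  refine ⟨g ⁻¹' ball F (g x) ((g y).2.2.unpair.1 + 1), ⟨h.isClosed_ball hx _, h.isOpen_ball _ _⟩,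
    mem_ball_self _ _, ?_⟩
  rintro (hy | ⟨h0, -, -, ⟨hl, -⟩ | ⟨-, -, hy⟩⟩)
  · exact hxy (g.injective hy.symm)
  · exact hx.elim (fun hc => hc h0) (fun hc => hc hl)
  · omega

/-- Two distinct special points differ in the first coordinate, whose fibres are clopen; any other
pair includes a centre with clopen balls. -/
theorem HasBalls.exists_isClopen (h : HasBalls F g) {x y : α} (hxy : x ≠ y) :
    ∃ S, IsClopen S ∧ x ∈ S ∧ y ∉ S := by
  by_cases hx : (g x).2.2 ≠ 0 ∨ (g x).2.1 ≠ []
  · exact h.exists_isClopen_of_ne_special hxy hx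
  by_cases hy : (g y).2.2 ≠ 0 ∨ (g y).2.1 ≠ []
  · obtain ⟨S, hS, h1, h2⟩ := h.exists_isClopen_of_ne_special hxy.symm hy
    exact ⟨Sᶜ, hS.compl, h2, not_not.2 h1⟩
  push Not at hx hy
  refine ⟨_, h.isClopen_fst_eq (g x).1, rfl, fun hyx => hxy (g.injective ?_)⟩
  exact Prod.ext hyx.symm (Prod.ext (hx.2.trans hy.2.symm) (hx.1.trans hy.1.symm))

theorem HasBalls.t25Space (h : HasBalls F g) : T25Space α where
  t2_5 x y hxy := by
    obtain ⟨S, hS, hx, hy⟩ := h.exists_isClopen hxy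
    have key : ∀ {T : Set α} {z : α}, IsClopen T → z ∈ T → T ∈ (𝓝 z).lift' closure :=
      fun {T z} hT hz => by
        have := Filter.mem_lift' (h := closure) (hT.isOpen.mem_nhds hz)
        rwa [hT.isClosed.closure_eq] at this
    exact Filter.disjoint_iff.2 ⟨S, key hS hx, Sᶜ, key hS.compl hy, disjoint_compl_right⟩

/-- The right side says that `(a, l, 0)` is outside the closure of the special ball of radius `m`,
for all long `l`. -/
theorem HasBalls.regularSpace_iff (h : HasBalls F g) :
    RegularSpace α ↔ ∀ a, ∃ m, ∀ l : List ℕ, m ≤ l.length →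
      ∃ n, ∀ w, F a l w → w.unpair.1 < n := by
  constructor
  · intro _ a
    obtain ⟨t, ht, htc, hts⟩ := exists_mem_nhds_isClosed_subset (X := α) (x := g.symm (a, [], 0))
      ((h.isOpen_ball (a, [], 0) 0).mem_nhds (by simpa using mem_ball_self _ _))
    obtain ⟨m, hm⟩ := h.mem_nhds_iff.1 ht
    rw [Equiv.apply_symm_apply] at hm
    -- The extra `1` makes `l` nonempty, so `(a, l, 0)` is not the special point.
    refine ⟨m + 1, fun l hl => ?_⟩
    have hl0 : l ≠ [] := by rintro rfl; simp at hl
    have hy : g.symm (a, l, 0) ∈ tᶜ := fun hy => by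
      rcases hts hy with hy | hy <;> simp [hl0] at hy
    obtain ⟨n, hn⟩ := (h _).1 htc.isOpen_compl _ hy
    rw [Equiv.apply_symm_apply] at hn
    -- The extra `1` rules out `w = 0`; then `(a, l, w)` lies both in `t` and in its complement.
    refine ⟨n + 1, fun w hw => ?_⟩
    by_contra! hwn
    have hw0 : w ≠ 0 := by rintro rfl; simp at hwn
    have h1 : g.symm (a, l, w) ∈ t := hm (by
      rw [Set.mem_preimage, Equiv.apply_symm_apply]
      refine Or.inr ?_
      exact ⟨rfl, hw0, rfl, Or.inl ⟨rfl, by dsimp only; omega, hw⟩⟩)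
    have h2 : g.symm (a, l, w) ∈ tᶜ := hn (by
      rw [Set.mem_preimage, Equiv.apply_symm_apply]
      refine Or.inr ?_
      exact ⟨rfl, hw0, rfl, Or.inr ⟨hl0, rfl, by dsimp only; omega⟩⟩)
    exact h2 h1
  · intro hF
    refine .of_exists_mem_nhds_isClosed_subset fun x s hs => ?_
    obtain ⟨n, hn⟩ := h.mem_nhds_iff.1 hs
    by_cases hx : (g x).2.2 ≠ 0 ∨ (g x).2.1 ≠ []
    · exact ⟨_, (h.isOpen_ball _ n).mem_nhds (mem_ball_self _ n), h.isClosed_ball hx n, hn⟩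
    push Not at hx
    obtain ⟨hx0, hxl⟩ := hx
    obtain ⟨m, hm⟩ := hF (g x).1
    refine ⟨_, (h.isOpen_ball _ (max n m)).mem_nhds (mem_ball_self _ _),
      h.isClosed_of_disjoint fun y hy0 hy => ?_,
      (Set.preimage_mono (ball_subset_ball (mem_ball_self _ _) (le_max_left _ _))).trans hn⟩
    -- A list shorter than the radius never meets the ball of `x`, so `0` serves there.
    obtain ⟨k, hk⟩ : ∃ k, max n m ≤ y.2.1.length → ∀ w, F (g x).1 y.2.1 w → w.unpair.1 < k := by
      by_cases hl : m ≤ y.2.1.length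
      · obtain ⟨k, hk⟩ := hm _ hl
        exact ⟨k, fun _ => hk⟩
      · exact ⟨0, fun hl' => absurd ((le_max_right _ _).trans hl') hl⟩
    refine ⟨k, fun z hz hzx => ?_⟩
    rcases hz with rfl | ⟨-, hz0, hz1, hz2⟩
    · exact hy hzx
    rcases hzx with rfl | ⟨-, -, hzx1, ⟨-, hzx2, hzx3⟩ | ⟨hzx2, -⟩⟩
    · exact hz0 hx0
    · rcases hz2 with ⟨hyl, -⟩ | ⟨-, hyl, hyk⟩
      · exact hy (Or.inl (Prod.ext (hz1.trans hzx1.symm)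
          (Prod.ext (hyl.trans hxl.symm) (hy0.trans hx0.symm))))
      · rw [← hyl] at hzx2 hzx3
        rw [← hzx1] at hzx3
        have := hk hzx2 _ hzx3
        omega
    · exact hzx2 hxl

theorem HasBalls.t3Space_iff (h : HasBalls F g) :
    T3Space α ↔ ∀ a, ∃ m, ∀ l : List ℕ, m ≤ l.length → ∃ n, ∀ w, F a l w → w.unpair.1 < n := by
  rw [← h.regularSpace_iff]
  have := h.t25Space
  exact ⟨fun _ => inferInstance, fun _ => inferInstance⟩

end Ball

/-- The `i`-th basic open set of the space constructed from `F`. -/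
def ballSeq (F : ℕ → List ℕ → ℕ → Prop) (i : ℕ) : Set ℕ :=
  {x | Denumerable.ofNat Point x ∈
    ball F (Denumerable.ofNat (Point × ℕ) i).1 (Denumerable.ofNat (Point × ℕ) i).2}

/-- The function that finds balls in the intersections of two balls; it does not depend on the
space. -/
def ballInter (i j x : ℕ) : ℕ :=
  Encodable.encode (Denumerable.ofNat Point x,
    max (Denumerable.ofNat (Point × ℕ) i).2 (Denumerable.ofNat (Point × ℕ) j).2)

theorem ballSeq_encode (F : ℕ → List ℕ → ℕ → Prop) (c : Point) (n : ℕ) :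
    ballSeq F (Encodable.encode (c, n)) = Denumerable.ofNat Point ⁻¹' ball F c n := by
  rw [ballSeq, Denumerable.ofNat_encode]
  rfl

theorem isBase_ballSeq (F : ℕ → List ℕ → ℕ → Prop) : IsBase (ballSeq F) ballInter where
  cover x := ⟨Encodable.encode (Denumerable.ofNat Point x, 0), by
    rw [ballSeq_encode]
    exact mem_ball_self _ _⟩
  inter i j x := by
    rintro ⟨hi, hj⟩
    rw [ballInter, ballSeq_encode]
    exact ⟨mem_ball_self _ _, fun y hy => ⟨ball_subset_ball hi (le_max_left _ _) hy,
      ball_subset_ball hj (le_max_right _ _) hy⟩⟩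

theorem hasBalls_of_basicOpen_eq {F : ℕ → List ℕ → ℕ → Prop} {e : ℕ} (he : e ∈ CSC)
    (h : ∀ i, basicOpen e i = ballSeq F i) :
    HasBalls (α := Space e) F (Denumerable.eqv Point).symm := by
  intro S
  rw [(isTopologicalBasis_basicOpen he).isOpen_iff]
  refine forall₂_congr fun x hx => ?_
  constructor
  · rintro ⟨_, ⟨i, rfl⟩, hxi, hi⟩
    dsimp only at hxi hi
    rw [h] at hxi hi
    exact ⟨_, (Set.preimage_mono (ball_subset_ball hxi le_rfl)).trans hi⟩
  · rintro ⟨n, hn⟩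
    refine ⟨_, ⟨Encodable.encode (Denumerable.ofNat Point x, n), rfl⟩, ?_, ?_⟩
    · dsimp only
      rw [h, ballSeq_encode]
      exact mem_ball_self _ _
    · dsimp only
      rw [h, ballSeq_encode]
      exact hn


/-! ### Computable predicates -/

section ComputablePred

variable {α β : Type*} [Primcodable α] [Primcodable β]

theorem _root_.ComputablePred.comp {p : β → Prop} {f : α → β} (hp : ComputablePred p)
    (hf : Computable f) : ComputablePred fun a => p (f a) := by
  obtain ⟨_, hp⟩ := hp
  exact ⟨fun a => inferInstance, Computable.comp hp hf⟩

theorem _root_.ComputablePred.and {p q : α → Prop} (hp : ComputablePred p)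
    (hq : ComputablePred q) : ComputablePred fun a => p a ∧ q a := by
  obtain ⟨_, hp⟩ := hp
  obtain ⟨_, hq⟩ := hq
  exact ⟨fun a => inferInstance, (Primrec.and.to_comp.comp hp hq).of_eq fun a => by simp⟩

theorem _root_.ComputablePred.or {p q : α → Prop} (hp : ComputablePred p)
    (hq : ComputablePred q) : ComputablePred fun a => p a ∨ q a :=
  (hp.not.and hq.not).not.of_eq fun a => by tauto

theorem _root_.ComputablePred.forall_lt {p : α → ℕ → Prop} {b : α → ℕ}
    (hp : ComputablePred fun x : α × ℕ => p x.1 x.2) (hb : Computable b) :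
    ComputablePred fun a => ∀ i < b a, p a i := by
  obtain ⟨f, hf, hpf⟩ := ComputablePred.computable_iff.1 hp
  have hpf' : ∀ a i, p a i ↔ f (a, i) = true := fun a i => iff_of_eq (congrFun hpf (a, i))
  refine ComputablePred.computable_iff.2 ⟨fun a => Nat.rec true (fun i r => r && f (a, i)) (b a),
    Computable.nat_rec hb (Computable.const true) (Primrec.and.to_comp.comp
      (Computable.snd.comp Computable.snd)
      (hf.comp (Computable.pair Computable.fst (Computable.fst.comp Computable.snd)))).to₂, ?_⟩
  funext a
  refine propext ?_
  beta_reduce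
  generalize b a = n
  induction n with
  | zero => simp
  | succ n ih => rw [Nat.forall_lt_succ_right, ih, hpf']; simp

theorem _root_.ComputablePred.exists_lt {p : α → ℕ → Prop} {b : α → ℕ}
    (hp : ComputablePred fun x : α × ℕ => p x.1 x.2) (hb : Computable b) :
    ComputablePred fun a => ∃ i < b a, p a i :=
  (ComputablePred.forall_lt (p := fun a i => ¬ p a i) hp.not hb).not.of_eq fun a => by simp

theorem _root_.Computable.eq [DecidableEq β] {f g : α → β} (hf : Computable f)
    (hg : Computable g) : ComputablePred fun a => f a = g a :=
  (PrimrecPred.computablePred (Primrec.eq (α := β))).comp (hf.pair hg)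

theorem _root_.Computable.nat_le {f g : α → ℕ} (hf : Computable f) (hg : Computable g) :
    ComputablePred fun a => f a ≤ g a :=
  (PrimrecPred.computablePred Primrec.nat_le).comp (hf.pair hg)

end ComputablePred

/-! ### Prenex normal forms -/

/-- The sets `B₁`, `B₃`, `B₅` enter through their complements and supply the universal quantifiers;
`B₂` and `B₄` supply the existential ones. -/
theorem mem_piClass_five {A : Set ℕ} : A ∈ PiClass 5 ↔ ∃ R : ℕ → ℕ → ℕ → ℕ → ℕ → ℕ → Prop,
    (ComputablePred fun v : ℕ × ℕ × ℕ × ℕ × ℕ × ℕ =>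
      R v.1 v.2.1 v.2.2.1 v.2.2.2.1 v.2.2.2.2.1 v.2.2.2.2.2) ∧
    ∀ e, e ∈ A ↔ ∀ a, ∃ b, ∀ c, ∃ d, ∀ f, R e a b c d f := by
  constructor
  · rintro ⟨B₁, ⟨B₂, ⟨B₃, ⟨B₄, ⟨B₅, h, h₅⟩, h₄⟩, h₃⟩, h₂⟩, h₁⟩
    refine ⟨fun e a b c d f =>
      Nat.pair (Nat.pair (Nat.pair (Nat.pair (Nat.pair e a) b) c) d) f ∈ B₅ᶜ, ?_, fun e => ?_⟩
    · have hp : Computable₂ Nat.pair := Primrec₂.natPair.to_comp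
      have h1 : Computable fun v : ℕ × ℕ × ℕ × ℕ × ℕ × ℕ => v.1 := Computable.fst
      have h2 : Computable fun v : ℕ × ℕ × ℕ × ℕ × ℕ × ℕ => v.2.1 :=
        Computable.fst.comp Computable.snd
      have h3 : Computable fun v : ℕ × ℕ × ℕ × ℕ × ℕ × ℕ => v.2.2.1 :=
        Computable.fst.comp (Computable.snd.comp Computable.snd)
      have h4 : Computable fun v : ℕ × ℕ × ℕ × ℕ × ℕ × ℕ => v.2.2.2.1 :=
        Computable.fst.comp (Computable.snd.comp (Computable.snd.comp Computable.snd))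
      have h5 : Computable fun v : ℕ × ℕ × ℕ × ℕ × ℕ × ℕ => v.2.2.2.2.1 :=
        Computable.fst.comp (Computable.snd.comp (Computable.snd.comp
          (Computable.snd.comp Computable.snd)))
      have h6 : Computable fun v : ℕ × ℕ × ℕ × ℕ × ℕ × ℕ => v.2.2.2.2.2 :=
        Computable.snd.comp (Computable.snd.comp (Computable.snd.comp
          (Computable.snd.comp Computable.snd)))
      exact ComputablePred.comp h
        (hp.comp (hp.comp (hp.comp (hp.comp (hp.comp h1 h2) h3) h4) h5) h6)
    · have g₁ : e ∈ A ↔ ∀ a, Nat.pair e a ∈ B₁ᶜ := by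
        rw [← not_iff_not]; simpa using h₁ e
      have g₃ : ∀ x, x ∈ B₂ ↔ ∀ c, Nat.pair x c ∈ B₃ᶜ := fun x => by
        rw [← not_iff_not]; simpa using h₃ x
      have g₅ : ∀ x, x ∈ B₄ ↔ ∀ f, Nat.pair x f ∈ B₅ᶜ := fun x => by
        rw [← not_iff_not]; simpa using h₅ x
      simp only [g₁, h₂, g₃, h₄, g₅]
  · rintro ⟨R, hR, hA⟩
    obtain ⟨t, ht, ht'⟩ : ∃ t : ℕ → ℕ × ℕ × ℕ × ℕ × ℕ × ℕ, Computable t ∧ ∀ e a b c d f,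
        t (Nat.pair (Nat.pair (Nat.pair (Nat.pair (Nat.pair e a) b) c) d) f) =
          (e, a, b, c, d, f) := by
      have k1 : Computable fun x : ℕ => x.unpair.1 := Computable.fst.comp Computable.unpair
      have k2 : Computable fun x : ℕ => x.unpair.2 := Computable.snd.comp Computable.unpair
      exact ⟨_, (((((k1.comp k1).comp k1).comp k1).comp k1).pair
        (((((k2.comp k1).comp k1).comp k1).comp k1).pair ((((k2.comp k1).comp k1).comp k1).pair
        (((k2.comp k1).comp k1).pair ((k2.comp k1).pair k2))))), fun e a b c d f => by simp⟩
    let S₅ : Set ℕ := {x | R (t x).1 (t x).2.1 (t x).2.2.1 (t x).2.2.2.1 (t x).2.2.2.2.1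
      (t x).2.2.2.2.2}
    let S₄ : Set ℕ := {x | ∀ f, Nat.pair x f ∈ S₅}
    let S₃ : Set ℕ := {x | ∃ d, Nat.pair x d ∈ S₄}
    let S₂ : Set ℕ := {x | ∀ c, Nat.pair x c ∈ S₃}
    let S₁ : Set ℕ := {x | ∃ b, Nat.pair x b ∈ S₂}
    have hS₅ : ComputablePred fun x => x ∈ S₅ := by
      have := ComputablePred.comp hR ht
      exact this
    refine ⟨S₁ᶜ, ?_, fun x => ?_⟩
    · rw [compl_compl]
      refine ⟨S₂, ?_, fun x => Iff.rfl⟩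
      refine ⟨S₃ᶜ, ?_, fun x => by simp [S₂]⟩
      rw [compl_compl]
      refine ⟨S₄, ?_, fun x => Iff.rfl⟩
      refine ⟨S₅ᶜ, ?_, fun x => by simp [S₄]⟩
      rw [compl_compl]
      exact hS₅
    · rw [Set.mem_compl_iff, hA]
      simp [S₁, S₂, S₃, S₄, S₅, ht']

/-! ### Indices of uniformly computable functions -/

/-- The s-m-n theorem, by currying a code for the uncurried function. -/
theorem exists_computable_index {F : ℕ → ℕ → ℕ} (hF : Computable₂ F) :
    ∃ h : ℕ → ℕ, Computable h ∧ ∀ e n, Φ (h e) n = Part.some (F e n) := by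
  obtain ⟨c, hc⟩ := Nat.Partrec.Code.exists_code.1 (Partrec₂.unpaired'.2 hF.partrec₂)
  refine ⟨fun e => Encodable.encode (Nat.Partrec.Code.curry c e), Computable.encode.comp
    (Nat.Partrec.Code.primrec₂_curry.to_comp.comp (Computable.const c) Computable.id),
    fun e n => ?_⟩
  simp [Φ, Nat.Partrec.Code.eval_curry, hc]

/-! ### The reduction -/

/-- Bounded search finds, for every entry of `l` and every `d` up to the first component of `w`, a
counterexample to `S`. -/
def Fires (S : ℕ → ℕ → ℕ → ℕ → Prop) (l : List ℕ) (w : ℕ) : Prop :=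
  ∀ b < l.length, ∀ d < w.unpair.1 + 1, ∃ f < w.unpair.2 + 1, ¬ S b (l.getD b 0) d f

theorem exists_forall_fires_iff (S : ℕ → ℕ → ℕ → ℕ → Prop) :
    (∃ m, ∀ l : List ℕ, m ≤ l.length → ∃ n, ∀ w, Fires S l w → w.unpair.1 < n) ↔
      ∃ b, ∀ c, ∃ d, ∀ f, S b c d f := by
  constructor
  · rintro ⟨m, hm⟩
    by_contra! h
    choose c hc using h
    -- A list of refuting values `c b` fires with unbounded first component.
    obtain ⟨n, hn⟩ := hm ((List.range m).map c) (by simp)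
    choose f hf using hc
    -- The sum bounds all the counterexamples `f b d` at once, so `Nat.pair n t` fires.
    let t := ∑ b ∈ Finset.range m, ∑ d ∈ Finset.range (n + 1), f b d
    have := hn (Nat.pair n t) fun b hb d hd => by
      simp only [List.length_map, List.length_range] at hb
      simp only [Nat.unpair_pair] at hd
      refine ⟨f b d, ?_, by simpa [hb] using hf b d⟩
      simp only [Nat.unpair_pair, Nat.lt_succ_iff]
      exact (Finset.single_le_sum (f := fun d => f b d) (fun _ _ => Nat.zero_le _)
        (Finset.mem_range.2 hd)).trans (Finset.single_le_sum
          (f := fun b => ∑ d ∈ Finset.range (n + 1), f b d) (fun _ _ => Nat.zero_le _)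
          (Finset.mem_range.2 hb))
    simp at this
  · rintro ⟨b, hb⟩
    refine ⟨b + 1, fun l hl => ?_⟩
    obtain ⟨d, hd⟩ := hb (l.getD b 0)
    refine ⟨d, fun w hw => ?_⟩
    by_contra! hdw
    obtain ⟨f, -, hf⟩ := hw b hl d (Nat.lt_succ_of_le hdw)
    exact hf (hd f)

section

variable {R : ℕ → ℕ → ℕ → ℕ → ℕ → ℕ → Prop}
  (hR : ComputablePred fun v : ℕ × ℕ × ℕ × ℕ × ℕ × ℕ =>
    R v.1 v.2.1 v.2.2.1 v.2.2.2.1 v.2.2.2.2.1 v.2.2.2.2.2)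

include hR

/-- All quantifiers in `Fires` are bounded, so decidability passes from `R`. -/
theorem computablePred_fires :
    ComputablePred fun v : ℕ × Point => Fires (R v.1 v.2.1) v.2.2.1 v.2.2.2 := by
  have u1 : Computable fun x : ℕ => x.unpair.1 := Computable.fst.comp Computable.unpair
  have u2 : Computable fun x : ℕ => x.unpair.2 := Computable.snd.comp Computable.unpair
  have l1 : Computable fun v : ℕ × Point => v.2.2.1 :=
    Computable.fst.comp (Computable.snd.comp Computable.snd)
  have w1 : Computable fun v : ℕ × Point => v.2.2.2 :=
    Computable.snd.comp (Computable.snd.comp Computable.snd)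
  refine ComputablePred.forall_lt ?_ (Computable.list_length.comp l1)
  refine ComputablePred.forall_lt (α := (ℕ × Point) × ℕ)
    (p := fun v d => ∃ f < v.1.2.2.2.unpair.2 + 1,
      ¬ R v.1.1 v.1.2.1 v.2 (v.1.2.2.1.getD v.2 0) d f) ?_
    (Computable.succ.comp (u1.comp (w1.comp Computable.fst)))
  refine ComputablePred.exists_lt (α := ((ℕ × Point) × ℕ) × ℕ)
    (p := fun v f => ¬ R v.1.1.1 v.1.1.2.1 v.1.2 (v.1.1.2.2.1.getD v.1.2 0) v.2 f) ?_
    (Computable.succ.comp (u2.comp (w1.comp (Computable.fst.comp Computable.fst))))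
  have v3 : Computable fun v : (((ℕ × Point) × ℕ) × ℕ) × ℕ => v.1.1.1 :=
    Computable.fst.comp (Computable.fst.comp Computable.fst)
  have b3 : Computable fun v : (((ℕ × Point) × ℕ) × ℕ) × ℕ => v.1.1.2 :=
    Computable.snd.comp (Computable.fst.comp Computable.fst)
  exact (ComputablePred.comp hR ((Computable.fst.comp v3).pair
    ((Computable.fst.comp (Computable.snd.comp v3)).pair (b3.pair
    (((Primrec.list_getD 0).to_comp.comp (l1.comp v3) b3).pair
    ((Computable.snd.comp Computable.fst).pair Computable.snd)))))).not

theorem computablePred_mem_ball : ComputablePred fun v : ℕ × (Point × ℕ) × Point =>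
    v.2.2 ∈ ball (fun a => Fires (R v.1 a)) v.2.1.1 v.2.1.2 := by
  have hx : Computable fun v : ℕ × (Point × ℕ) × Point => v.2.2 :=
    Computable.snd.comp Computable.snd
  have hc : Computable fun v : ℕ × (Point × ℕ) × Point => v.2.1.1 :=
    Computable.fst.comp (Computable.fst.comp Computable.snd)
  have hn : Computable fun v : ℕ × (Point × ℕ) × Point => v.2.1.2 :=
    Computable.snd.comp (Computable.fst.comp Computable.snd)
  have p1 : Computable fun x : Point => x.1 := Computable.fst
  have p2 : Computable fun x : Point => x.2.1 := Computable.fst.comp Computable.snd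
  have p3 : Computable fun x : Point => x.2.2 := Computable.snd.comp Computable.snd
  have u1 : Computable fun x : ℕ => x.unpair.1 := Computable.fst.comp Computable.unpair
  have h0 : Computable fun _ : ℕ × (Point × ℕ) × Point => 0 := Computable.const 0
  have hnil : Computable fun _ : ℕ × (Point × ℕ) × Point => ([] : List ℕ) := Computable.const []
  have hf := (computablePred_fires hR).comp
    (Computable.pair Computable.fst hx : Computable fun v : ℕ × (Point × ℕ) × Point => (v.1, v.2.2))
  exact (Computable.eq hx hc).or
    ((Computable.eq (p3.comp hc) h0).and ((Computable.eq (p3.comp hx) h0).not.and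
    ((Computable.eq (p1.comp hc) (p1.comp hx)).and
    (((Computable.eq (p2.comp hc) hnil).and
      ((Computable.nat_le hn (Computable.list_length.comp (p2.comp hx))).and hf)).or
    ((Computable.eq (p2.comp hc) hnil).not.and ((Computable.eq (p2.comp hc) (p2.comp hx)).and
      (Computable.nat_le hn (u1.comp (p3.comp hx)))))))))

end


theorem exists_reduction {B : Set ℕ} (hB : B ∈ PiClass 5) : ∃ f : ℕ → ℕ, Computable f ∧
    ∀ e, f e ∈ T2CSC ∧ f e ∈ T25CSC ∧ (e ∈ B ↔ f e ∈ T3CSC) := by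
  classical
  obtain ⟨R, hR, hB⟩ := mem_piClass_five.1 hB
  have u1 : Computable fun x : ℕ => x.unpair.1 := Computable.fst.comp Computable.unpair
  have u2 : Computable fun x : ℕ => x.unpair.2 := Computable.snd.comp Computable.unpair
  obtain ⟨m, hm, hmΦ⟩ := exists_computable_index
    (F := fun e p => (decide (Denumerable.ofNat Point p.unpair.2 ∈ ball (fun a => Fires (R e a))
      (Denumerable.ofNat (Point × ℕ) p.unpair.1).1
      (Denumerable.ofNat (Point × ℕ) p.unpair.1).2)).toNat)
    ((Primrec.dom_finite Bool.toNat).to_comp.comp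
      ((computablePred_mem_ball hR).comp (Computable.fst.pair
        (((Computable.ofNat (Point × ℕ)).comp (u1.comp Computable.snd)).pair
          ((Computable.ofNat Point).comp (u2.comp Computable.snd))))).decide)
  obtain ⟨n, hn, hnΦ⟩ := exists_computable_index
    (F := fun _ p => ballInter p.unpair.1 p.unpair.2.unpair.1 p.unpair.2.unpair.2)
    (Computable.encode.comp (((Computable.ofNat Point).comp
      (u2.comp (u2.comp Computable.snd))).pair (Primrec.nat_max.to_comp.comp
        (Computable.snd.comp ((Computable.ofNat (Point × ℕ)).comp (u1.comp Computable.snd)))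
        (Computable.snd.comp ((Computable.ofNat (Point × ℕ)).comp
          (u1.comp (u2.comp Computable.snd)))))))
  refine ⟨fun e => Nat.pair (m e) (n e), Primrec₂.natPair.to_comp.comp hm hn, fun e => ?_⟩
  have hsets : ComputesSets (Nat.pair (m e) (n e)).unpair.1
      (ballSeq fun a => Fires (R e a)) := fun i x => by
    rw [Nat.unpair_pair, hmΦ]
    simp only [Nat.unpair_pair]
    exact ⟨fun h => congrArg (fun b : Bool => Part.some b.toNat) (decide_eq_true h),
      fun h => congrArg (fun b : Bool => Part.some b.toNat) (decide_eq_false h)⟩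
  have hcsc : Nat.pair (m e) (n e) ∈ CSC :=
    ⟨_, ballInter, isBase_ballSeq _, hsets, fun i j x => by simp [hnΦ]⟩
  have hballs := hasBalls_of_basicOpen_eq hcsc fun i => basicOpen_eq hsets i
  have := hballs.t25Space
  refine ⟨⟨hcsc, inferInstance⟩, ⟨hcsc, inferInstance⟩, ?_⟩
  simp only [T3CSC, Set.mem_ofPred_eq, hcsc, true_and, hballs.t3Space_iff,
    exists_forall_fires_iff, hB]

/-! ### The upper bound -/

/-- Within `s` steps, `e` is seen to answer `v` to the question whether `x` is in its `i`-th basic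
open set. -/
def Answers (e s i x v : ℕ) : Prop :=
  Nat.Partrec.Code.evaln s (Denumerable.ofNat Nat.Partrec.Code e.unpair.1) (Nat.pair i x) = some v

/-- Answers seen are correct, and by monotonicity in the number of steps the correct answer is seen
from some stage on. -/
theorem exists_forall_answers_iff {e : ℕ} (he : e ∈ CSC) (i x : ℕ) :
    (∀ s, (Answers e s i x 1 → x ∈ basicOpen e i) ∧ (Answers e s i x 0 → x ∉ basicOpen e i)) ∧
      ∀ᶠ s in Filter.atTop, ((x ∈ basicOpen e i → Answers e s i x 1) ∧
        (x ∉ basicOpen e i → Answers e s i x 0)) := by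
  obtain ⟨U, k, -, hU, -⟩ := he
  obtain ⟨h1, h0⟩ := hU i x
  rw [basicOpen_eq hU]
  have key : ∀ v, (∃ s, Answers e s i x v) ↔ Φ e.unpair.1 (Nat.pair i x) = Part.some v := fun v =>
    (Nat.Partrec.Code.evaln_complete.trans Iff.rfl).symm.trans Part.eq_some_iff.symm
  have mono : ∀ v, (∃ s, Answers e s i x v) → ∀ᶠ s in Filter.atTop, Answers e s i x v := by
    rintro v ⟨s, hs⟩
    exact Filter.eventually_atTop.2 ⟨s, fun t ht => Nat.Partrec.Code.evaln_mono ht hs⟩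
  refine ⟨fun s => ⟨fun h => ?_, fun h hx => ?_⟩, ?_⟩
  · by_contra hx
    exact absurd (Part.some_injective (((key 1).1 ⟨s, h⟩).symm.trans (h0 hx))) (by decide)
  · exact absurd (Part.some_injective (((key 0).1 ⟨s, h⟩).symm.trans (h1 hx))) (by decide)
  · by_cases hx : x ∈ U i
    · filter_upwards [mono 1 ((key 1).2 (h1 hx))] with s hs using ⟨fun _ => hs, fun h => absurd hx h⟩
    · filter_upwards [mono 0 ((key 0).2 (h0 hx))] with s hs using ⟨fun h => absurd h hx, fun _ => hs⟩

/-- The matrix of the prenex form of regularity. -/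
def RegularMatrix (e x i j y k z s : ℕ) : Prop :=
  ¬ Answers e s i x 1 ∨ (¬ Answers e s j x 0 ∧ (¬ Answers e s i y 0 ∨
    (¬ Answers e s k y 0 ∧ (¬ Answers e s k z 1 ∨ ¬ Answers e s j z 1))))

/-- Each membership claim is weakened to "not yet refuted at stage `s`". A true formula thus holds
at every stage, and at a stage where all six answers are in, the matrix is the formula. -/
theorem forall_regularMatrix_iff {e : ℕ} (he : e ∈ CSC) (x i j y k z : ℕ) :
    (∀ s, RegularMatrix e x i j y k z s) ↔
      (x ∈ basicOpen e i → x ∈ basicOpen e j ∧ (y ∉ basicOpen e i →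
        y ∈ basicOpen e k ∧ (z ∈ basicOpen e k → z ∉ basicOpen e j))) := by
  have key := exists_forall_answers_iff he
  constructor
  · intro h
    obtain ⟨s, h1, h2, h3, h4, h5, h6⟩ := ((key i x).2.and ((key j x).2.and ((key i y).2.and
      ((key k y).2.and ((key k z).2.and (key j z).2))))).exists
    have := h s
    unfold RegularMatrix at this
    grind
  · intro h s
    have h1 := (key i x).1 s
    have h2 := (key j x).1 s
    have h3 := (key i y).1 s
    have h4 := (key k y).1 s
    have h5 := (key k z).1 s
    have h6 := (key j z).1 s
    unfold RegularMatrix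
    grind

theorem regularSpace_iff {e : ℕ} (he : e ∈ CSC) : RegularSpace (Space e) ↔
    ∀ x i, x ∈ basicOpen e i → ∃ j, x ∈ basicOpen e j ∧ ∀ y, y ∉ basicOpen e i →
      ∃ k, y ∈ basicOpen e k ∧ ∀ z, z ∈ basicOpen e k → z ∉ basicOpen e j := by
  have hb := isTopologicalBasis_basicOpen he
  constructor
  · intro _ x i hx
    obtain ⟨t, ht, htc, hti⟩ := exists_mem_nhds_isClosed_subset (X := Space e)
      ((hb.isOpen ⟨i, rfl⟩).mem_nhds hx)
    obtain ⟨_, ⟨j, rfl⟩, hxj, hjt⟩ := hb.mem_nhds_iff.1 ht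
    refine ⟨j, hxj, fun y hy => ?_⟩
    obtain ⟨_, ⟨k, rfl⟩, hyk, hkt⟩ := hb.isOpen_iff.1 htc.isOpen_compl y fun hyt => hy (hti hyt)
    exact ⟨k, hyk, fun z hz hzj => hkt hz (hjt hzj)⟩
  · intro h
    refine .of_exists_mem_nhds_isClosed_subset fun x s hs => ?_
    obtain ⟨_, ⟨i, rfl⟩, hxi, his⟩ := hb.mem_nhds_iff.1 hs
    obtain ⟨j, hxj, hj⟩ := h x i hxi
    refine ⟨closure (X := Space e) (basicOpen e j), Filter.mem_of_superset
      ((hb.isOpen ⟨j, rfl⟩).mem_nhds hxj) (subset_closure (X := Space e)),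
      isClosed_closure (X := Space e), fun y hy => his ?_⟩
    by_contra hyi
    obtain ⟨k, hyk, hk⟩ := hj y hyi
    obtain ⟨z, hzk, hzj⟩ := (mem_closure_iff (X := Space e)).1 hy _ (hb.isOpen ⟨k, rfl⟩) hyk
    exact hk z hzk hzj

theorem computablePred_answers {α : Type*} [Primcodable α] {e s i x : α → ℕ} (he : Computable e)
    (hs : Computable s) (hi : Computable i) (hx : Computable x) (v : ℕ) :
    ComputablePred fun a => Answers (e a) (s a) (i a) (x a) v :=
  Computable.eq (Nat.Partrec.Code.primrec_evaln.to_comp.comp ((hs.pair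
    ((Computable.ofNat Nat.Partrec.Code).comp (Computable.fst.comp (Computable.unpair.comp he)))).pair
      (Primrec₂.natPair.to_comp.comp hi hx))) (Computable.const (some v))

theorem exists_mem_piClass_forall_regularSpace_iff :
    ∃ B ∈ PiClass 5, ∀ e ∈ CSC, e ∈ B ↔ RegularSpace (Space e) := by
  -- `p` codes `(x, i)` and `q` codes `(z, s)`, so the stage joins the innermost universal
  -- quantifier at no cost.
  let R : ℕ → ℕ → ℕ → ℕ → ℕ → ℕ → Prop := fun e p j y k q =>
    RegularMatrix e p.unpair.1 p.unpair.2 j y k q.unpair.1 q.unpair.2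
  refine ⟨{e | ∀ p, ∃ j, ∀ y, ∃ k, ∀ q, R e p j y k q},
    mem_piClass_five.2 ⟨R, ?_, fun e => Iff.rfl⟩, fun e he => ?_⟩
  · have u1 : Computable fun x : ℕ => x.unpair.1 := Computable.fst.comp Computable.unpair
    have u2 : Computable fun x : ℕ => x.unpair.2 := Computable.snd.comp Computable.unpair
    have h1 : Computable fun v : ℕ × ℕ × ℕ × ℕ × ℕ × ℕ => v.1 := Computable.fst
    have h2 : Computable fun v : ℕ × ℕ × ℕ × ℕ × ℕ × ℕ => v.2.1 :=
      Computable.fst.comp Computable.snd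
    have h3 : Computable fun v : ℕ × ℕ × ℕ × ℕ × ℕ × ℕ => v.2.2.1 :=
      Computable.fst.comp (Computable.snd.comp Computable.snd)
    have h4 : Computable fun v : ℕ × ℕ × ℕ × ℕ × ℕ × ℕ => v.2.2.2.1 :=
      Computable.fst.comp (Computable.snd.comp (Computable.snd.comp Computable.snd))
    have h5 : Computable fun v : ℕ × ℕ × ℕ × ℕ × ℕ × ℕ => v.2.2.2.2.1 :=
      Computable.fst.comp (Computable.snd.comp (Computable.snd.comp
        (Computable.snd.comp Computable.snd)))
    have h6 : Computable fun v : ℕ × ℕ × ℕ × ℕ × ℕ × ℕ => v.2.2.2.2.2 :=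
      Computable.snd.comp (Computable.snd.comp (Computable.snd.comp
        (Computable.snd.comp Computable.snd)))
    have hx := u1.comp h2
    have hi := u2.comp h2
    have hz := u1.comp h6
    have hs := u2.comp h6
    exact (computablePred_answers h1 hs hi hx 1).not.or
      ((computablePred_answers h1 hs h3 hx 0).not.and ((computablePred_answers h1 hs hi h4 0).not.or
        ((computablePred_answers h1 hs h5 h4 0).not.and ((computablePred_answers h1 hs h5 hz 1).not.or
          (computablePred_answers h1 hs h3 hz 1).not))))
  · have hq : ∀ p j y k, (∀ q, R e p j y k q) ↔ ∀ z, (p.unpair.1 ∈ basicOpen e p.unpair.2 →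
        p.unpair.1 ∈ basicOpen e j ∧ (y ∉ basicOpen e p.unpair.2 →
          y ∈ basicOpen e k ∧ (z ∈ basicOpen e k → z ∉ basicOpen e j))) := fun p j y k => by
      simp only [← forall_regularMatrix_iff he]
      exact ⟨fun h z s => by simpa [R] using h (Nat.pair z s), fun h q => h _ _⟩
    simp only [Set.mem_ofPred_eq, hq, regularSpace_iff he]
    constructor
    · intro h x i hx
      obtain ⟨j, hj⟩ := h (Nat.pair x i)
      simp only [Nat.unpair_pair] at hj
      refine ⟨j, ?_, fun y hy => ?_⟩
      · obtain ⟨k, hk⟩ := hj 0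
        exact (hk 0 hx).1
      · obtain ⟨k, hk⟩ := hj y
        exact ⟨k, ((hk 0 hx).2 hy).1, fun z => ((hk z hx).2 hy).2⟩
    · intro h p
      -- Prenexing moves `j` and `k` in front of the hypotheses; where these fail, the witness `0`
      -- is arbitrary.
      by_cases hx : p.unpair.1 ∈ basicOpen e p.unpair.2
      · obtain ⟨j, hxj, hj⟩ := h _ _ hx
        refine ⟨j, fun y => ?_⟩
        by_cases hy : y ∈ basicOpen e p.unpair.2
        · exact ⟨0, fun z _ => ⟨hxj, fun hy' => absurd hy hy'⟩⟩
        · obtain ⟨k, hyk, hk⟩ := hj y hy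
          exact ⟨k, fun z _ => ⟨hxj, fun _ => ⟨hyk, hk z⟩⟩⟩
      · exact ⟨0, fun y => ⟨0, fun z hx' => absurd hx' hx⟩⟩

/-- Inside the Hausdorff indices, regular already means T₃, and the behaviour of the Π⁰₅ set off
`CSC` is irrelevant. -/
theorem isWithin_T3CSC {C : Set ℕ} (hC : C ⊆ T2CSC) (h : T3CSC ⊆ C) :
    IsWithin (PiClass 5) T3CSC C := by
  obtain ⟨B, hB, hBreg⟩ := exists_mem_piClass_forall_regularSpace_iff
  refine ⟨B, hB, Set.Subset.antisymm (fun e he => ?_) fun e he => ?_⟩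
  · have := he.2
    exact ⟨(hBreg e he.1).2 inferInstance, h he⟩
  · obtain ⟨hcsc, _⟩ := hC he.2
    have := (hBreg e hcsc).1 he.1
    exact ⟨hcsc, inferInstance⟩

/-! ### Coincidence of the regularity properties -/

/-- This collapses the properties: a second-countable regular space is normal, and metrizable by
Urysohn's theorem if also T₀. -/
theorem secondCountableTopology {e : ℕ} (he : e ∈ CSC) : SecondCountableTopology (Space e) :=
  (isTopologicalBasis_basicOpen he).secondCountableTopology (Set.countable_range _)

theorem T3CSC_eq_MetCSC : T3CSC = MetCSC := by
  ext e
  refine and_congr_right fun he => ?_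
  have := secondCountableTopology he
  exact ⟨fun _ => inferInstance, fun _ => inferInstance⟩

theorem T3CSC_eq_T4CSC : T3CSC = T4CSC := by
  ext e
  refine and_congr_right fun he => ?_
  have := secondCountableTopology he
  exact ⟨fun _ => inferInstance, fun _ => inferInstance⟩

theorem T25CSC_subset_T2CSC : T25CSC ⊆ T2CSC := fun _ he => by
  have := he.2
  exact ⟨he.1, inferInstance⟩

theorem T3CSC_subset_T25CSC : T3CSC ⊆ T25CSC := fun _ he => by
  have := he.2
  exact ⟨he.1, inferInstance⟩

theorem isCompleteWithin_T2CSC : IsCompleteWithin (PiClass 5) T3CSC T2CSC :=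
  ⟨isWithin_T3CSC subset_rfl (T3CSC_subset_T25CSC.trans T25CSC_subset_T2CSC), fun _ hB => by
    obtain ⟨f, hf, h⟩ := exists_reduction hB
    exact ⟨f, hf, fun e => ⟨(h e).1, (h e).2.2⟩⟩⟩

theorem isCompleteWithin_T25CSC : IsCompleteWithin (PiClass 5) T3CSC T25CSC :=
  ⟨isWithin_T3CSC T25CSC_subset_T2CSC T3CSC_subset_T25CSC, fun _ hB => by
    obtain ⟨f, hf, h⟩ := exists_reduction hB
    exact ⟨f, hf, fun e => (h e).2⟩⟩

end CSCIndex

theorem mainTheorem1 :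
    -- regular spaces within the Hausdorff and within the Urysohn spaces
    CSCIndex.IsCompleteWithin (CSCIndex.PiClass 5) CSCIndex.T3CSC CSCIndex.T2CSC ∧
    CSCIndex.IsCompleteWithin (CSCIndex.PiClass 5) CSCIndex.T3CSC CSCIndex.T25CSC ∧
    -- a single reduction serves both: it always produces Urysohn, hence Hausdorff, spaces
    (∀ B ∈ CSCIndex.PiClass 5, ∃ f : ℕ → ℕ, Computable f ∧
      ∀ e, f e ∈ CSCIndex.T2CSC ∧ f e ∈ CSCIndex.T25CSC ∧ (e ∈ B ↔ f e ∈ CSCIndex.T3CSC)) ∧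
    -- regular, normal and metrizable spaces coincide
    CSCIndex.T3CSC = CSCIndex.T4CSC ∧
    CSCIndex.T4CSC = CSCIndex.MetCSC ∧
    -- normal spaces
    CSCIndex.IsCompleteWithin (CSCIndex.PiClass 5) CSCIndex.T4CSC CSCIndex.T2CSC ∧
    CSCIndex.IsCompleteWithin (CSCIndex.PiClass 5) CSCIndex.T4CSC CSCIndex.T25CSC ∧
    -- metrizable spaces
    CSCIndex.IsCompleteWithin (CSCIndex.PiClass 5) CSCIndex.MetCSC CSCIndex.T2CSC ∧
    CSCIndex.IsCompleteWithin (CSCIndex.PiClass 5) CSCIndex.MetCSC CSCIndex.T25CSC := by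
  rw [← CSCIndex.T3CSC_eq_T4CSC, ← CSCIndex.T3CSC_eq_MetCSC]
  exact ⟨CSCIndex.isCompleteWithin_T2CSC, CSCIndex.isCompleteWithin_T25CSC,
    fun _ => CSCIndex.exists_reduction, rfl, rfl,
    CSCIndex.isCompleteWithin_T2CSC, CSCIndex.isCompleteWithin_T25CSC,
    CSCIndex.isCompleteWithin_T2CSC, CSCIndex.isCompleteWithin_T25CSC⟩
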